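/- Let $F$ be a field of characteristic $0$. An associative dialgebra over $F$ is an $F$-vector space $D$ with bilinear products $\dashv,\vdash$ satisfying $(a\dashv b)\vdash c=(a\vdash b)\vdash c$, $a\dashv(b\dashv c)=a\dashv(b\vdash c)$, $(a\dashv b)\dashv c=a\dashv(b\dashv c)$, $(a\vdash b)\vdash c=a\vdash(b\vdash c)$ and $(a\vdash b)\dashv c=a\vdash(b\dashv c)$. Its Jordan triple diproducts are the trilinear operations $$(a,b,c)_1=a\dashv(b\dashv c)+(c\vdash b)\vdash a,\qquad (a,b,c)_2=(a\vdash b)\dashv c+(c\vdash b)\dashv a .$$ Consider polynomial identities for two trilinear operations $(\cdot,\cdot,\cdot)_1,(\cdot,\cdot,\cdot)_2$, i.e. elements of the free nonassociative algebra over $F$ with two ternary operations; the degree of a monomial is the number of occurrences of variables in it. An identity is a consequence of a set of identities if it holds in every $F$-vector space with two trilinear operations in which all identities of the set hold. Theorem. (a) The following eight identities hold for the Jordan triple diproducts of every associative dialgebra over $F$: \begin{align*} &(a,b,c)_2 \equiv (c,b,a)_2,\\ &(a,(b,c,d)_1,e)_1 \equiv (a,(b,c,d)_2,e)_1,\\ &(a,b,(c,d,e)_1)_1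 \equiv (a,b,(c,d,e)_2)_1,\\ &((a,b,c)_1,d,e)_2 \equiv ((a,b,c)_2,d,e)_2,\\ &((e,d,c)_1,b,a)_1 \equiv ((e,b,a)_1,d,c)_1-(e,(d,a,b)_1,c)_1+(e,d,(c,b,a)_1)_1,\\ &((e,d,c)_2,b,a)_1 \equiv ((e,b,a)_1,d,c)_2-(e,(d,a,b)_1,c)_2+(e,d,(c,b,a)_1)_2,\\ &((e,d,c)_1,b,a)_2 \equiv ((e,b,a)_2,d,c)_1-(e,(b,a,d)_1,c)_2+((c,b,a)_2,d,e)_1,\\ &(a,(b,c,d)_2,e)_2 \equiv ((c,b,a)_1,d,e)_1+((c,d,a)_1,b,e)_1-(c,(b,a,d)_1,e)_1. \end{align*} (b) Every polynomial identity of degree at most $5$ (multilinear or not) that holds for the Jordan triple diproducts of all associative dialgebras over $F$ is a consequence of these eight. (c) The eight identities are independent: none of them is a consequence of the other seven. (d) The set of these eight identities is equivalent (each set consists of consequences of the other) to the following set of identities: \begin{align*} &(a,b,c)_2\equiv(c,b,a)_2,\\ &(a,(b,c,d)_1,e)_1\equiv(a,(b,c,d)_2,e)_1\equiv(a,(d,c,b)_1,e)_1,\\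 &(a,b,(c,d,e)_1)_1\equiv(a,b,(c,d,e)_2)_1\equiv(a,b,(e,d,c)_1)_1,\\ &((a,b,c)_1,d,e)_2\equiv((a,b,c)_2,d,e)_2\equiv((c,b,a)_1,d,e)_2,\\ &((e,d,c)_1,b,a)_1\equiv((e,b,a)_1,d,c)_1-(e,(d,a,b)_1,c)_1+(e,d,(c,b,a)_1)_1,\\ &((e,d,c)_2,b,a)_1\equiv((e,b,a)_1,d,c)_2-(e,(d,a,b)_1,c)_2+(e,d,(c,b,a)_1)_2,\\ &(a,b,(c,d,e)_1)_1\equiv((a,b,c)_1,d,e)_1-(c,(b,a,d)_2,e)_2+((a,b,e)_1,d,c)_1,\\ &(a,b,(c,d,e)_1)_2\equiv((a,b,c)_2,d,e)_1-(c,(b,a,d)_1,e)_2+((a,b,e)_2,d,c)_1. \end{align*} This set is the output, after elimination of the third operation, of the Kolesnikov–Pozhidaev (KP) algorithm for the defining identities of Jordan triple systems, $\{a,b,c\}\equiv\{c,b,a\}$ and $\{a,b,\{c,d,e\}\}\equiv\{\{a,b,c\},d,e\}-\{c,\{b,a,d\},e\}+\{c,d,\{a,b,e\}\}$. That algorithm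 yields the following identities in three trilinear operations $\{\cdot,\cdot,\cdot\}_1,\{\cdot,\cdot,\cdot\}_2,\{\cdot,\cdot,\cdot\}_3$. First, for each of the two identities and each variable $x$ in it, replace in every monomial each symbol $\{\cdot,\cdot,\cdot\}$ by $\{\cdot,\cdot,\cdot\}_j$ if $x$ occurs in its $j$-th argument, by $\{\cdot,\cdot,\cdot\}_1$ if $x$ occurs to its left, and by $\{\cdot,\cdot,\cdot\}_3$ if $x$ occurs to its right. Second, for all $i\ne j$ and all $k,\ell$ in $\{1,2,3\}$, the value of $\{a_1,a_2,a_3\}_j$ with $a_i=\{b_1,b_2,b_3\}_k$ is equal to its value with $a_i=\{b_1,b_2,b_3\}_\ell$. (e) Three trilinear operations $\{\cdot,\cdot,\cdot\}_1,\{\cdot,\cdot,\cdot\}_2,\{\cdot,\cdot,\cdot\}_3$ on an $F$-vector space satisfy all identities produced by the KP algorithm as just described if and only if $\{a,b,c\}_3=\{c,b,a\}_1$ for all $a,b,c$ and the first two operations satisfy the eight identities. -/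

import Mathlib

namespace JordanTriple

/-- Nonassociative monomials in variables from `X`, built with one ternary operation symbol for
each label in `ι`. For `ι = Fin n` the label `k` is the operation with subscript `k + 1`. -/
inductive Monomial (ι X : Type) : Type
  | var (x : X) : Monomial ι X
  | op (k : ι) (s t r : Monomial ι X) : Monomial ι X

namespace Monomial

variable {ι κ X : Type}

/-- The variables of a monomial, from left to right and with repetitions. -/
def vars : Monomial ι X → List X
  | var x => [x]
  | op _ s t r => s.vars ++ t.vars ++ r.vars

/-- The degree of a monomial: the number of occurrences of variables. -/
def degree (m : Monomial ι X) : ℕ := m.vars.length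

/-- The value of a monomial for given ternary operations and given values of the variables. -/
def eval {T : Type*} (ω : ι → T → T → T → T) (v : X → T) : Monomial ι X → T
  | var x => v x
  | op k s t r => ω k (s.eval ω v) (t.eval ω v) (r.eval ω v)

/-- Replace every operation symbol by the one with label `k`. -/
def relabel (k : κ) : Monomial ι X → Monomial κ X
  | var x => var x
  | op _ s t r => op k (s.relabel k) (t.relabel k) (r.relabel k)

/-- The Kolesnikov-Pozhidaev conversion of a multilinear monomial in one ternary operation, with
the variable `x` (which has to occur in it) as the central argument: an operation symbol with `x`
in its `j`-th argument becomes the `j`-th new symbol; a symbol with `x` in none of its arguments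
becomes the first new symbol if `x` is to the left of it, and the third if `x` is to the right. -/
def kp [DecidableEq X] (x : X) : Monomial Unit X → Monomial (Fin 3) X
  | var y => var y
  | op _ s t r =>
    if x ∈ s.vars then op 0 (s.kp x) (t.relabel 0) (r.relabel 0)
    else if x ∈ t.vars then op 1 (s.relabel 2) (t.kp x) (r.relabel 0)
    else op 2 (s.relabel 2) (t.relabel 2) (r.kp x)

end Monomial

/-- Polynomials: elements of the free nonassociative algebra over `F`, with the ternary operations
labelled by `ι`, on countably many generators. -/
abbrev Poly (F : Type*) [Field F] (ι : Type) := Monomial ι ℕ →₀ F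

section Identities

variable {F : Type*} [Field F] {ι : Type} {T : Type*} [AddCommGroup T] [Module F T]

/-- The value of a polynomial for given operations and given values of the variables. -/
def Poly.eval (ω : ι → T → T → T → T) (v : ℕ → T) (f : Poly F ι) : T :=
  f.sum fun m c => c • m.eval ω v

/-- All monomials that occur in `f` have degree at most `n`. -/
def Poly.DegreeLE (f : Poly F ι) (n : ℕ) : Prop := ∀ m ∈ f.support, m.degree ≤ n

/-- The polynomial `f` is an identity for the operations `ω`. -/
def Satisfies (ω : ι → T → T → T → T) (f : Poly F ι) : Prop := ∀ v : ℕ → T, f.eval ω v = 0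

end Identities

/-- Trilinear maps `T × T × T → T`, in curried form. -/
abbrev Trilinear (F T : Type*) [Field F] [AddCommGroup T] [Module F T] :=
  T →ₗ[F] T →ₗ[F] T →ₗ[F] T

/-- A family of trilinear maps as a family of plain ternary operations. -/
def ops {F T ι : Type*} [Field F] [AddCommGroup T] [Module F T] (ω : ι → Trilinear F T) :
    ι → T → T → T → T := fun k a b c => ω k a b c

/-- The identity `f` is a consequence of the identities in `S`: every vector space with trilinear
operations that satisfies all identities in `S` satisfies `f`. -/
def IsConsequence.{u, w} {F : Type u} [Field F] {ι : Type} (S : Set (Poly F ι)) (f : Poly F ι) :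
    Prop :=
  ∀ (T : Type (max u w)) [AddCommGroup T] [Module F T] (ω : ι → Trilinear F T),
    (∀ g ∈ S, Satisfies (ops ω) g) → Satisfies (ops ω) f

/-- Associative dialgebra structures on a vector space `D`, with the left product `⊣` and the right
product `⊢`. -/
structure AssocDialgebra (F D : Type*) [Field F] [AddCommGroup D] [Module F D] where
  left : D →ₗ[F] D →ₗ[F] D
  right : D →ₗ[F] D →ₗ[F] D
  left_bar : ∀ a b c, right (left a b) c = right (right a b) c
  right_bar : ∀ a b c, left a (left b c) = left a (right b c)
  left_assoc : ∀ a b c, left (left a b) c = left a (left b c)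
  right_assoc : ∀ a b c, right (right a b) c = right a (right b c)
  inner_assoc : ∀ a b c, left (right a b) c = right a (left b c)

/-- The Jordan triple diproducts of an associative dialgebra; a hat marks the center of a monomial:
`(a,b,c)₁ = â b c + c b â = a ⊣ (b ⊣ c) + (c ⊢ b) ⊢ a` and
`(a,b,c)₂ = a b̂ c + c b̂ a = (a ⊢ b) ⊣ c + (c ⊢ b) ⊣ a`. -/
def diproduct {F D : Type*} [Field F] [AddCommGroup D] [Module F D] (A : AssocDialgebra F D) :
    Fin 2 → D → D → D → D :=
  ![fun a b c => A.left a (A.left b c) + A.right (A.right c b) a,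
    fun a b c => A.left (A.right a b) c + A.left (A.right c b) a]

/-- The polynomial `f` is an identity for the Jordan triple diproducts of every associative
dialgebra over `F`. -/
def IsDiproductIdentity.{u, w} {F : Type u} [Field F] (f : Poly F (Fin 2)) : Prop :=
  ∀ (D : Type (max u w)) [AddCommGroup D] [Module F D] (A : AssocDialgebra F D),
    Satisfies (diproduct A) f

/-- A monomial as a polynomial. -/
noncomputable def mon {F : Type*} [Field F] {ι : Type} (m : Monomial ι ℕ) : Poly F ι :=
  Finsupp.single m 1

/-- The monomial `(r,s,t)₁` in two ternary operations. -/
def p₁ (r s t : Monomial (Fin 2) ℕ) : Monomial (Fin 2) ℕ := .op 0 r s t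

/-- The monomial `(r,s,t)₂` in two ternary operations. -/
def p₂ (r s t : Monomial (Fin 2) ℕ) : Monomial (Fin 2) ℕ := .op 1 r s t

/-- The monomial `{r,s,t}` in one ternary operation. -/
def br (r s t : Monomial Unit ℕ) : Monomial Unit ℕ := .op () r s t

/-- The eight identities; an identity `l ≡ r` is written as the polynomial `l - r`. -/
noncomputable def eightIdentities (F : Type*) [Field F] : Fin 8 → Poly F (Fin 2) :=
  let a : Monomial (Fin 2) ℕ := .var 0
  let b : Monomial (Fin 2) ℕ := .var 1
  let c : Monomial (Fin 2) ℕ := .var 2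
  let d : Monomial (Fin 2) ℕ := .var 3
  let e : Monomial (Fin 2) ℕ := .var 4
  ![mon (p₂ a b c) - mon (p₂ c b a),
    mon (p₁ a (p₁ b c d) e) - mon (p₁ a (p₂ b c d) e),
    mon (p₁ a b (p₁ c d e)) - mon (p₁ a b (p₂ c d e)),
    mon (p₂ (p₁ a b c) d e) - mon (p₂ (p₂ a b c) d e),
    mon (p₁ (p₁ e d c) b a) -
      (mon (p₁ (p₁ e b a) d c) - mon (p₁ e (p₁ d a b) c) + mon (p₁ e d (p₁ c b a))),
    mon (p₁ (p₂ e d c) b a) -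
      (mon (p₂ (p₁ e b a) d c) - mon (p₂ e (p₁ d a b) c) + mon (p₂ e d (p₁ c b a))),
    mon (p₂ (p₁ e d c) b a) -
      (mon (p₁ (p₂ e b a) d c) - mon (p₂ e (p₁ b a d) c) + mon (p₁ (p₂ c b a) d e)),
    mon (p₂ a (p₂ b c d) e) -
      (mon (p₁ (p₁ c b a) d e) + mon (p₁ (p₁ c d a) b e) - mon (p₁ c (p₁ b a d) e))]

/-- The identities that the Kolesnikov-Pozhidaev algorithm gives for Jordan triple systems, after
the third operation has been eliminated through `{a,b,c}₃ = {c,b,a}₁`. -/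
noncomputable def kpIdentities (F : Type*) [Field F] : Fin 11 → Poly F (Fin 2) :=
  let a : Monomial (Fin 2) ℕ := .var 0
  let b : Monomial (Fin 2) ℕ := .var 1
  let c : Monomial (Fin 2) ℕ := .var 2
  let d : Monomial (Fin 2) ℕ := .var 3
  let e : Monomial (Fin 2) ℕ := .var 4
  ![mon (p₂ a b c) - mon (p₂ c b a),
    mon (p₁ a (p₁ b c d) e) - mon (p₁ a (p₂ b c d) e),
    mon (p₁ a (p₂ b c d) e) - mon (p₁ a (p₁ d c b) e),
    mon (p₁ a b (p₁ c d e)) - mon (p₁ a b (p₂ c d e)),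
    mon (p₁ a b (p₂ c d e)) - mon (p₁ a b (p₁ e d c)),
    mon (p₂ (p₁ a b c) d e) - mon (p₂ (p₂ a b c) d e),
    mon (p₂ (p₂ a b c) d e) - mon (p₂ (p₁ c b a) d e),
    mon (p₁ (p₁ e d c) b a) -
      (mon (p₁ (p₁ e b a) d c) - mon (p₁ e (p₁ d a b) c) + mon (p₁ e d (p₁ c b a))),
    mon (p₁ (p₂ e d c) b a) -
      (mon (p₂ (p₁ e b a) d c) - mon (p₂ e (p₁ d a b) c) + mon (p₂ e d (p₁ c b a))),
    mon (p₁ a b (p₁ c d e)) -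
      (mon (p₁ (p₁ a b c) d e) - mon (p₂ c (p₂ b a d) e) + mon (p₁ (p₁ a b e) d c)),
    mon (p₂ a b (p₁ c d e)) -
      (mon (p₁ (p₂ a b c) d e) - mon (p₂ c (p₁ b a d) e) + mon (p₁ (p₂ a b e) d c))]

/-- The defining identities of Jordan triple systems. A pair `(n, f)` stands for a multilinear
polynomial `f` of degree `n` in the variables `0, …, n - 1`. -/
noncomputable def jordanTripleSystemIdentities (F : Type*) [Field F] : Set (ℕ × Poly F Unit) :=
  let a : Monomial Unit ℕ := .var 0
  let b : Monomial Unit ℕ := .var 1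
  let c : Monomial Unit ℕ := .var 2
  let d : Monomial Unit ℕ := .var 3
  let e : Monomial Unit ℕ := .var 4
  {(3, mon (br a b c) - mon (br c b a)),
   (5, mon (br a b (br c d e)) -
      (mon (br (br a b c) d e) - mon (br c (br b a d) e) + mon (br c d (br a b e))))}

/-- The monomial `{a₁,a₂,a₃}ⱼ` with its `i`-th argument replaced by `{b₁,b₂,b₃}ₖ`; the `aₘ` are the
variables `0, 1, 2` and the `bₘ` the variables `3, 4, 5`. -/
def nested (j i k : Fin 3) : Monomial (Fin 3) ℕ :=
  let arg : Fin 3 → Monomial (Fin 3) ℕ := fun m =>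
    if m = i then .op k (.var 3) (.var 4) (.var 5) else .var m
  .op j (arg 0) (arg 1) (arg 2)

/-- The output of the Kolesnikov-Pozhidaev algorithm for a set of multilinear identities in one
ternary operation. First part: every variable of every identity is made the central argument.
Second part: the new operations are interchangeable in the `i`-th argument of the `j`-th new
operation, for `i ≠ j`. -/
noncomputable def kpOutput {F : Type*} [Field F] (S : Set (ℕ × Poly F Unit)) :
    Set (Poly F (Fin 3)) :=
  {g | ∃ p ∈ S, ∃ x < p.1, g = Finsupp.mapDomain (Monomial.kp x) p.2} ∪
  {g | ∃ i j k l : Fin 3, i ≠ j ∧ g = mon (nested j i k) - mon (nested j i l)}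

end JordanTriple

universe u w

/-!
# Identities of degree at most five for Jordan triple diproducts

Write `f = (·,·,·)₁` and `g = (·,·,·)₂`. For plain operations the eight identities form the
predicate `IsTripleDisystem f g`, and the reduced Kolesnikov-Pozhidaev identities form
`IsKPDisystem f g`; the two are equivalent by short rewritings.

**Completeness.** Let `T` satisfy the eight identities. The degree-5 part of the free dialgebra
has the words with a marked letter (the center) as a basis. Up to the interchange identities and
the symmetry of `g`, monomials of degree 5 in `T` correspond to *edges*: each one expands to the
words `v`, `w` and their reversals, where `w` arises from the word `v` by exchanging two letters
in odd positions (up to reversal, exchanging the two letters in even positions is the same as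
exchanging the first and last letters). For fixed odd-position letters `x, y, z` and
even-position letters `p, q` there are six words up to reversal, and the nine edges form the
graph `K₃,₃` between even and odd arrangements. They are

* `L_z = {{x,p,y},q,z}`, `M_y = {x,{p,y,q},z}`, `R_x = {x,p,{y,q,z}}`, one of each for every
  choice of the letter in the index,

and each word lies on one edge of each kind, with three different indices. The remaining four
identities say exactly that `L_z + M_z + R_z = ΣL = ΣM = ΣR` for each `z`, with the marked letter
fixed, and these are all the relations between edges of `K₃,₃`. Write `S` for the common sum. Then
`v ↦ (1/6) (the three edges at v) - (1/12) S` is a linear left inverse of the expansion of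
monomials into words: the edges at the two ends of `L_z` add up to
`2 L_z + 2 S - L_x - L_y = 3 L_z + S`, and likewise for the other kinds. The formula
makes sense for arbitrary values of the letters, so it gives a linear map `splitWord` from the free dialgebra to `T` that sends the value
of each monomial of degree at most 5 at the generators to its value in `T`
(`linearCombination_splitWord_eval`). An identity of the free dialgebra is mapped to an identity
of `T`; no multilinearization is needed.

**Independence.** In a graded space with basis `x` in degree 1, `(x,x,x)₁` and `(x,x,x)₂` in
degree 3 and one vector in degree 5, each degree-5 identity is a single linear condition on the
structure constants `α` (`eval_nilpotentModel`), and one can violate these conditions one at a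
time.

**The Kolesnikov-Pozhidaev output.** Marking the third variable of `{a,b,c} ≡ {c,b,a}` gives
`{a,b,c}₃ = {c,b,a}₁`; after substituting this everywhere, the remaining identities are those of
`IsKPDisystem` (`satisfies_kpOutput_iff`).
-/

namespace JordanTriple

/-! ### Evaluation of polynomials, and the identities for plain operations -/

section Evaluation

variable {F : Type*} [Field F] {ι : Type} {T : Type*} [AddCommGroup T] [Module F T]

theorem Poly.eval_eq_linearCombination (ω : ι → T → T → T → T) (v : ℕ → T) (f : Poly F ι) :
    f.eval ω v = Finsupp.linearCombination F (fun m => m.eval ω v) f := rfl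

@[simp] theorem Poly.eval_sub (ω : ι → T → T → T → T) (v : ℕ → T) (f g : Poly F ι) :
    Poly.eval ω v (f - g) = f.eval ω v - g.eval ω v := by
  simp only [Poly.eval_eq_linearCombination, map_sub]

@[simp] theorem Poly.eval_add (ω : ι → T → T → T → T) (v : ℕ → T) (f g : Poly F ι) :
    Poly.eval ω v (f + g) = f.eval ω v + g.eval ω v := by
  simp only [Poly.eval_eq_linearCombination, map_add]

@[simp] theorem Poly.eval_mon (ω : ι → T → T → T → T) (v : ℕ → T) (m : Monomial ι ℕ) :
    Poly.eval ω v (mon m : Poly F ι) = m.eval ω v := by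
  simp [Poly.eval_eq_linearCombination, mon]

end Evaluation

/-- The eight identities, for plain operations `f = (·,·,·)₁` and `g = (·,·,·)₂`. The last four fields
are named after the inner and the outer operation of their left-hand sides. -/
structure IsTripleDisystem {T : Type*} [AddCommGroup T] (f g : T → T → T → T) : Prop where
  symm : ∀ a b c, g a b c = g c b a
  mid : ∀ a b c d e, f a (f b c d) e = f a (g b c d) e
  right : ∀ a b c d e, f a b (f c d e) = f a b (g c d e)
  left : ∀ a b c d e, g (f a b c) d e = g (g a b c) d e
  one_one : ∀ a b c d e,
    f (f e d c) b a = f (f e b a) d c - f e (f d a b) c + f e d (f c b a)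
  two_one : ∀ a b c d e,
    f (g e d c) b a = g (f e b a) d c - g e (f d a b) c + g e d (f c b a)
  one_two : ∀ a b c d e,
    g (f e d c) b a = f (g e b a) d c - g e (f b a d) c + f (g c b a) d e
  two_two : ∀ a b c d e,
    g a (g b c d) e = f (f c b a) d e + f (f c d a) b e - f c (f b a d) e

/-- The identities `kpIdentities`, for plain operations `f = (·,·,·)₁` and `g = (·,·,·)₂`. -/
structure IsKPDisystem {T : Type*} [AddCommGroup T] (f g : T → T → T → T) : Prop where
  symm : ∀ a b c, g a b c = g c b a
  mid : ∀ a b c d e, f a (f b c d) e = f a (g b c d) e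
  mid' : ∀ a b c d e, f a (g b c d) e = f a (f d c b) e
  right : ∀ a b c d e, f a b (f c d e) = f a b (g c d e)
  right' : ∀ a b c d e, f a b (g c d e) = f a b (f e d c)
  left : ∀ a b c d e, g (f a b c) d e = g (g a b c) d e
  left' : ∀ a b c d e, g (g a b c) d e = g (f c b a) d e
  one_one : ∀ a b c d e,
    f (f e d c) b a = f (f e b a) d c - f e (f d a b) c + f e d (f c b a)
  two_one : ∀ a b c d e,
    f (g e d c) b a = g (f e b a) d c - g e (f d a b) c + g e d (f c b a)
  one_right : ∀ a b c d e,
    f a b (f c d e) = f (f a b c) d e - g c (g b a d) e + f (f a b e) d c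
  two_right : ∀ a b c d e,
    g a b (f c d e) = f (g a b c) d e - g c (f b a d) e + f (g a b e) d c

section Satisfies

variable (F : Type*) [Field F] {T : Type*} [AddCommGroup T] [Module F T]

theorem satisfies_eightIdentities_iff (ω : Fin 2 → T → T → T → T) :
    (∀ i, Satisfies ω (eightIdentities F i)) ↔ IsTripleDisystem (ω 0) (ω 1) := by
  constructor
  · intro h
    have H (a b c d e : T) (i : Fin 8) := h i fun n => [a, b, c, d, e].getD n 0
    simp only [eightIdentities, Fin.forall_fin_succ] at H
    simp [Monomial.eval, p₁, p₂, sub_eq_zero] at H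
    constructor <;> intro a b c <;> try intro d e
    · exact (H a b c 0 0).1
    · exact (H a b c d e).2.1
    · exact (H a b c d e).2.2.1
    · exact (H a b c d e).2.2.2.1
    · exact (H a b c d e).2.2.2.2.1
    · exact (H a b c d e).2.2.2.2.2.1
    · exact (H a b c d e).2.2.2.2.2.2.1
    · exact (H a b c d e).2.2.2.2.2.2.2
  · rintro ⟨h0, h1, h2, h3, h4, h5, h6, h7⟩ i v
    fin_cases i <;> simp [eightIdentities, Monomial.eval, p₁, p₂, sub_eq_zero]
    exacts [h0 .., h1 .., h2 .., h3 .., h4 .., h5 .., h6 .., h7 ..]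

theorem satisfies_kpIdentities_iff (ω : Fin 2 → T → T → T → T) :
    (∀ i, Satisfies ω (kpIdentities F i)) ↔ IsKPDisystem (ω 0) (ω 1) := by
  constructor
  · intro h
    have H (a b c d e : T) (i : Fin 11) := h i fun n => [a, b, c, d, e].getD n 0
    simp only [kpIdentities, Fin.forall_fin_succ] at H
    simp [Monomial.eval, p₁, p₂, sub_eq_zero] at H
    constructor <;> intro a b c <;> try intro d e
    · exact (H a b c 0 0).1
    · exact (H a b c d e).2.1
    · exact (H a b c d e).2.2.1
    · exact (H a b c d e).2.2.2.1
    · exact (H a b c d e).2.2.2.2.1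
    · exact (H a b c d e).2.2.2.2.2.1
    · exact (H a b c d e).2.2.2.2.2.2.1
    · exact (H a b c d e).2.2.2.2.2.2.2.1
    · exact (H a b c d e).2.2.2.2.2.2.2.2.1
    · exact (H a b c d e).2.2.2.2.2.2.2.2.2.1
    · exact (H a b c d e).2.2.2.2.2.2.2.2.2.2
  · rintro ⟨h0, h1, h2, h3, h4, h5, h6, h7, h8, h9, h10⟩ i v
    fin_cases i <;> simp [kpIdentities, Monomial.eval, p₁, p₂, sub_eq_zero]
    exacts [h0 .., h1 .., h2 .., h3 .., h4 .., h5 .., h6 .., h7 .., h8 .., h9 .., h10 ..]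

end Satisfies

/-! ### Diproducts satisfy the eight identities -/

section Dialgebra

variable {F D : Type*} [Field F] [AddCommGroup D] [Module F D]

theorem isTripleDisystem_diproduct (A : AssocDialgebra F D) :
    IsTripleDisystem (diproduct A 0) (diproduct A 1) := by
  constructor <;> intro a b c <;> try intro d e
  all_goals
    simp only [diproduct, Matrix.cons_val_zero, Matrix.cons_val_one, map_add,
      LinearMap.add_apply, A.left_bar, ← A.right_bar, A.left_assoc, A.right_assoc, A.inner_assoc]
    try abel

end Dialgebra

/-! ### Equivalence with the Kolesnikov-Pozhidaev identities -/

namespace IsTripleDisystem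

variable {T : Type*} [AddCommGroup T] {f g : T → T → T → T}

theorem mid_symm (h : IsTripleDisystem f g) (a b c d e : T) :
    f a (f b c d) e = f a (f d c b) e := by
  rw [h.mid, h.symm, ← h.mid]

theorem right_symm (h : IsTripleDisystem f g) (a b c d e : T) :
    f a b (f c d e) = f a b (f e d c) := by
  rw [h.right, h.symm, ← h.right]

theorem left_symm (h : IsTripleDisystem f g) (a b c d e : T) :
    g (f a b c) d e = g (f c b a) d e := by
  rw [h.left, h.symm a b c, ← h.left]

theorem one_right (h : IsTripleDisystem f g) (a b c d e : T) :
    f a b (f c d e) = f (f a b c) d e - g c (g b a d) e + f (f a b e) d c := by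
  rw [h.two_two, h.one_one c d e b a, h.right_symm a b c]
  abel

theorem isKPDisystem (h : IsTripleDisystem f g) : IsKPDisystem f g where
  symm := h.symm
  mid := h.mid
  mid' a b c d e := by rw [← h.mid, h.mid_symm]
  right := h.right
  right' a b c d e := by rw [← h.right, h.right_symm]
  left := h.left
  left' a b c d e := by rw [← h.left, h.left_symm]
  one_one := h.one_one
  two_one := h.two_one
  one_right := h.one_right
  two_right a b c d e := by
    rw [h.symm a b, h.one_two, h.symm c b a, h.symm e b a]

end IsTripleDisystem

theorem IsKPDisystem.isTripleDisystem {T : Type*} [AddCommGroup T] {f g : T → T → T → T}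
    (h : IsKPDisystem f g) : IsTripleDisystem f g where
  symm := h.symm
  mid := h.mid
  right := h.right
  left := h.left
  one_one := h.one_one
  two_one := h.two_one
  one_two a b c d e := by
    rw [h.symm, h.two_right, h.symm a b e, h.symm a b c]
  two_two a b c d e := by
    have h1 := h.one_right c b a d e
    have h2 := h.one_one a d e b c
    rw [h.right, h.right'] at h1
    rw [h2] at h1
    linear_combination (norm := abel) h1

/-! ### Linear relations between monomials of degree five -/

section LatinSquares

variable {T : Type*} [AddCommGroup T]

/-- The sum `ΣL` of the monomials `{{·,p,·},q,·}` over the three choices of the last letter among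
`a, x, y`, when the marked letter `a` is in an odd position. For the last summand, in which `a` would
come last, the reversed form is used. -/
def oddSum (f : T → T → T → T) (a p x q y : T) : T :=
  f (f a p x) q y + f (f a p y) q x + f a q (f x p y)

/-- The sum `ΣL` of the monomials `{{·,b,·},q,·}` over the three choices of the last letter among
`x, y, z`, when the marked letter `b` is in an even position. -/
def evenSum (f g : T → T → T → T) (x b y q z : T) : T :=
  f (g x b y) q z + f (g y b z) q x + f (g x b z) q y

namespace IsTripleDisystem

variable {f g : T → T → T → T}

/-- The equality `ΣL = ΣR` for a marked letter in an odd position: exchanging `p` and `q` exchanges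
the monomials `L` and `R`. -/
theorem oddSum_swap (h : IsTripleDisystem f g) (a p x q y : T) :
    oddSum f a p x q y = oddSum f a q x p y := by
  have h1 := h.one_one y q x p a
  have h2 := h.one_one y p x q a
  rw [h.mid_symm a q y p x] at h2
  unfold oddSum
  linear_combination (norm := abel) h1 - h2

theorem oddSum_comm (h : IsTripleDisystem f g) (a p x q y : T) :
    oddSum f a p x q y = oddSum f a p y q x := by
  unfold oddSum
  rw [h.right_symm a q x p y]
  abel

/-- `L_y + M_y + R_y = ΣL` for an unmarked index `y`. -/
theorem odd_row (h : IsTripleDisystem f g) (a p x q y : T) :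
    f (f a p x) q y + f a (f p y q) x + f (f a q x) p y = oddSum f a p x q y := by
  rw [h.one_one y p x q a, h.mid_symm a q, oddSum]
  abel

/-- `L_a + M_a + R_a = ΣL` for the marked letter `a` as index. -/
theorem odd_row_center (h : IsTripleDisystem f g) (a p x q y : T) :
    f a q (f x p y) + g x (g p a q) y + f a p (f x q y) = oddSum f a p x q y := by
  have h1 := h.one_one x p y q a
  rw [h.right_symm a q, h.mid_symm a q] at h1
  rw [h.two_two, h.oddSum_swap, oddSum, h1]
  abel

theorem evenSum_comm_right (h : IsTripleDisystem f g) (x b y q z : T) :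
    evenSum f g x b y q z = evenSum f g x b z q y := by
  unfold evenSum
  rw [h.symm z b y]
  abel

theorem evenSum_comm_left (h : IsTripleDisystem f g) (x b y q z : T) :
    evenSum f g x b y q z = evenSum f g y b x q z := by
  unfold evenSum
  rw [h.symm y b x]
  abel

/-- `L_z + R_z + M_z = ΣL`, when the marked letter `b` is in an even position. -/
theorem even_row (h : IsTripleDisystem f g) (x b y q z : T) :
    f (g x b y) q z + g (f x q y) b z + g x (f b z q) y = evenSum f g x b y q z := by
  rw [evenSum, h.one_two]
  abel

/-- `ΣL = ΣR`, when the marked letter `b` is in an even position. -/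
theorem evenSum_eq_right (h : IsTripleDisystem f g) (x b y q z : T) :
    evenSum f g x b y q z = g (f x q y) b z + g (f y q z) b x + g (f x q z) b y := by
  have h1 := h.two_one z q y b x
  have h2 := h.even_row x b y q z
  rw [h.symm x b (f y q z)] at h1
  linear_combination (norm := abel) h1 - h2

end IsTripleDisystem
end LatinSquares
/-! ### The free associative dialgebra -/

section FreeDialgebra

/-- Words in the letters `0, 1, 2, …` with a marked letter, the center. The universe is arbitrary, so
that the vector space on these words can be placed in the universe of `IsDiproductIdentity`. -/
structure CenteredWord : Type w where
  before : List ℕ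
  center : ℕ
  after : List ℕ

open Finsupp in
/-- The bilinear extension of a binary operation on a basis. -/
noncomputable def bilinearExtension (F : Type*) [Field F] {B : Type*} (μ : B → B → B) :
    (B →₀ F) →ₗ[F] (B →₀ F) →ₗ[F] (B →₀ F) :=
  linearCombination F fun x => linearCombination F fun y => single (μ x y) 1

theorem bilinearExtension_single (F : Type*) [Field F] {B : Type*} (μ : B → B → B) (x y : B)
    (r s : F) :
    bilinearExtension F μ (Finsupp.single x r) (Finsupp.single y s) =
      Finsupp.single (μ x y) (r * s) := by
  simp [bilinearExtension]

/-- The free associative dialgebra on `ℕ`, with the words with a center as a basis. Both products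
concatenate words; `⊣` keeps the center of the left factor and `⊢` that of the right factor. -/
noncomputable def freeDialgebra (F : Type u) [Field F] :
    AssocDialgebra F (CenteredWord.{w} →₀ F) := by
  refine
    { left := bilinearExtension F fun x y =>
        ⟨x.before, x.center, x.after ++ y.before ++ y.center :: y.after⟩
      right := bilinearExtension F fun x y =>
        ⟨x.before ++ x.center :: x.after ++ y.before, y.center, y.after⟩
      left_bar := ?_
      right_bar := ?_
      left_assoc := ?_
      right_assoc := ?_
      inner_assoc := ?_ }
  all_goals
    intro a b c
    induction a using Finsupp.induction_linear with
    | zero => simp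
    | add a a' h h' => simp only [map_add, LinearMap.add_apply, h, h']
    | single x r =>
    induction b using Finsupp.induction_linear with
    | zero => simp
    | add b b' h h' => simp only [map_add, LinearMap.add_apply, h, h']
    | single y s =>
    induction c using Finsupp.induction_linear with
    | zero => simp
    | add c c' h h' => simp only [map_add, h, h']
    | single z t =>
      simp only [bilinearExtension_single, mul_assoc, List.append_assoc, List.cons_append]

end FreeDialgebra

/-! ### A left inverse of the expansion into words -/

section LeftInverse

variable (F : Type*) [Field F] {T : Type*} [AddCommGroup T] [Module F T]

/-- The value assigned to the word `a p x q y` with center `a`: one sixth of the sum of the three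
monomials whose expansion contains this word, minus one twelfth of `ΣL`. -/
noncomputable def splitWord₁ (f : T → T → T → T) (a p x q y : T) : T :=
  (1 / 6 : F) • (f (f a p x) q y + f a p (f x q y) + f a (f p x q) y) -
    (1 / 12 : F) • oddSum f a p x q y

/-- The value assigned to the word `x b y q z` with center `b`, by the recipe of `splitWord₁`. -/
noncomputable def splitWord₂ (f g : T → T → T → T) (x b y q z : T) : T :=
  (1 / 6 : F) • (f (g x b y) q z + g (f y q z) b x + g x (f b y q) z) -
    (1 / 12 : F) • evenSum f g x b y q z

/-- The value assigned to the word `x p a q y` with center `a`, by the recipe of `splitWord₁`. -/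
noncomputable def splitWord₃ (f g : T → T → T → T) (x p a q y : T) : T :=
  (1 / 6 : F) • (f (f a p x) q y + f (f a q y) p x + g x (g p a q) y) -
    (1 / 12 : F) • oddSum f a p x q y

/-- The left inverse of the expansion into words, on the basis, for values `v` of the letters. A word
and its reversal have the same image; only words of length 1, 3 and 5 matter. -/
noncomputable def splitWord (f g : T → T → T → T) (v : ℕ → T) : CenteredWord → T
  | ⟨[], a, []⟩ => v a
  | ⟨[], a, [b, c]⟩ => (1 / 2 : F) • f (v a) (v b) (v c)
  | ⟨[a], b, [c]⟩ => (1 / 2 : F) • g (v a) (v b) (v c)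
  | ⟨[a, b], c, []⟩ => (1 / 2 : F) • f (v c) (v b) (v a)
  | ⟨[], a, [b, c, d, e]⟩ => splitWord₁ F f (v a) (v b) (v c) (v d) (v e)
  | ⟨[a], b, [c, d, e]⟩ => splitWord₂ F f g (v a) (v b) (v c) (v d) (v e)
  | ⟨[a, b], c, [d, e]⟩ => splitWord₃ F f g (v a) (v b) (v c) (v d) (v e)
  | ⟨[a, b, c], d, [e]⟩ => splitWord₂ F f g (v e) (v d) (v c) (v b) (v a)
  | ⟨[a, b, c, d], e, []⟩ => splitWord₁ F f (v e) (v d) (v c) (v b) (v a)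
  | _ => 0

namespace IsTripleDisystem

variable {f g : T → T → T → T}

theorem splitWord₃_reverse (h : IsTripleDisystem f g) (a b c d e : T) :
    splitWord₃ F f g e d c b a = splitWord₃ F f g a b c d e := by
  unfold splitWord₃
  rw [← h.oddSum_swap, ← h.oddSum_comm, h.symm e, h.symm d, add_comm (f (f c d e) b a)]

variable [CharZero F]

/-- The two words in the expansion of `{{a,b,c},d,e}`, each counted together with its reversal, are
sent to this monomial; here `a` is marked. The following lemmas treat the other monomials. -/
theorem split_one_left (h : IsTripleDisystem f g) (a b c d e : T) :
    (2 : F) • (splitWord₁ F f a b c d e + splitWord₃ F f g c b a d e) = f (f a b c) d e := by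
  have h1 := h.odd_row_center a b c d e
  have h2 := h.odd_row a b e d c
  rw [← h.oddSum_comm a b c d e] at h2
  unfold splitWord₁ splitWord₃
  rw [oddSum] at *
  linear_combination (norm := module) (1 / 3 : F) • h1 + (1 / 3 : F) • h2

theorem split_one_mid (h : IsTripleDisystem f g) (a b c d e : T) :
    (2 : F) • (splitWord₁ F f a b c d e + splitWord₁ F f a d c b e) = f a (f b c d) e := by
  have h1 := h.odd_row_center a b c d e
  have h2 := h.two_two c b a d e
  unfold splitWord₁
  rw [h.mid_symm a d, ← h.oddSum_swap a b c d e]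
  linear_combination (norm := module) (1 / 3 : F) • h1 - (1 / 3 : F) • h2

theorem split_one_right (h : IsTripleDisystem f g) (a b c d e : T) :
    (2 : F) • (splitWord₁ F f a b c d e + splitWord₁ F f a b e d c) = f a b (f c d e) := by
  have h1 := h.odd_row_center a b c d e
  have h2 := h.two_two c b a d e
  have h3 := h.odd_row a b c d e
  unfold splitWord₁
  rw [h.right_symm a b e, ← h.oddSum_comm a b c d e]
  rw [oddSum] at *
  linear_combination (norm := module) (1 / 3 : F) • h3 - (1 / 3 : F) • h1 + (1 / 3 : F) • h2

theorem split_two_left (h : IsTripleDisystem f g) (a b c d e : T) :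
    (2 : F) • (splitWord₂ F f g a b c d e + splitWord₂ F f g c b a d e) = f (g a b c) d e := by
  have h1 := h.even_row a b e d c
  have h2 := h.even_row c b e d a
  unfold splitWord₂
  rw [← h.evenSum_comm_right a b c d e] at h1
  rw [← h.evenSum_comm_right c b a d e, ← h.evenSum_comm_left a b c d e] at h2
  rw [← h.evenSum_comm_left a b c d e, h.symm c b a]
  rw [evenSum] at *
  linear_combination (norm := module) (1 / 3 : F) • h1 + (1 / 3 : F) • h2

theorem split_two_right (h : IsTripleDisystem f g) (a b c d e : T) :
    (2 : F) • (splitWord₂ F f g a b c d e + splitWord₂ F f g a b e d c) = g a b (f c d e) := by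
  have h1 := h.even_row a b c d e
  have h2 := h.even_row a b e d c
  have h3 := h.evenSum_eq_right a b c d e
  rw [← h.evenSum_comm_right a b c d e] at h2
  unfold splitWord₂
  rw [← h.evenSum_comm_right a b c d e, h.left_symm e d c, h.symm a b (f c d e)]
  linear_combination (norm := module) (1 / 3 : F) • h1 + (1 / 3 : F) • h2 + (1 / 3 : F) • h3

theorem split_two_mid_one (h : IsTripleDisystem f g) (a b c d e : T) :
    (2 : F) • (splitWord₂ F f g a b c d e + splitWord₂ F f g e b c d a) = g a (f b c d) e := by
  have h1 := h.even_row a b e d c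
  have h2 := h.evenSum_eq_right a b c d e
  rw [← h.evenSum_comm_right a b c d e] at h1
  unfold splitWord₂
  rw [h.evenSum_comm_right e b c d a, ← h.evenSum_comm_left a b e d c,
    ← h.evenSum_comm_right a b c d e, h.left_symm c d a, h.symm e (f b c d), h.symm e b c]
  rw [evenSum] at *
  linear_combination (norm := module) -(1 / 3 : F) • h2 - (1 / 3 : F) • h1

theorem split_two_mid_two (h : IsTripleDisystem f g) (a b c d e : T) :
    (2 : F) • (splitWord₃ F f g a b c d e + splitWord₃ F f g a d c b e) = g a (g b c d) e := by
  have h1 := h.odd_row_center c b a d e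
  have h2 := h.oddSum_swap c b a d e
  unfold splitWord₃
  rw [h.symm d c b, ← h.oddSum_swap c b a d e]
  unfold oddSum at *
  linear_combination (norm := module) (-1 / 3 : F) • h1 - (1 / 3 : F) • h2

end IsTripleDisystem

end LeftInverse

/-! ### Identities of degree at most five -/

namespace Monomial

variable {ι X : Type}

theorem degree_op (k : ι) (s t r : Monomial ι X) :
    (op k s t r).degree = s.degree + t.degree + r.degree := by
  simp [degree, vars, add_assoc]

theorem degree_pos (m : Monomial ι X) : 0 < m.degree := by
  induction m with
  | var x => simp [degree, vars]
  | op k s t r hs ht hr => rw [degree_op]; omega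

theorem eq_var_of_degree_lt_three {m : Monomial ι X} (hm : m.degree < 3) : ∃ x, m = var x := by
  cases m with
  | var x => exact ⟨x, rfl⟩
  | op k s t r =>
    have := s.degree_pos
    have := t.degree_pos
    have := r.degree_pos
    rw [degree_op] at hm
    omega

theorem eq_op_var_of_degree_lt_five {m : Monomial ι X} (hm : m.degree < 5) :
    (∃ x, m = var x) ∨ m.degree = 3 ∧ ∃ k a b c, m = op k (var a) (var b) (var c) := by
  cases m with
  | var x => exact .inl ⟨x, rfl⟩
  | op k s t r =>
    have := s.degree_pos
    have := t.degree_pos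
    have := r.degree_pos
    rw [degree_op] at hm
    obtain ⟨a, rfl⟩ := eq_var_of_degree_lt_three (m := s) (by omega)
    obtain ⟨b, rfl⟩ := eq_var_of_degree_lt_three (m := t) (by omega)
    obtain ⟨c, rfl⟩ := eq_var_of_degree_lt_three (m := r) (by omega)
    exact .inr ⟨rfl, k, a, b, c, rfl⟩

/-- Operations are ternary, so that a monomial of degree at most 5 has at most two of them. -/
@[elab_as_elim]
theorem cases_of_degree_le_five {p : Monomial ι X → Prop} (m : Monomial ι X) (hm : m.degree ≤ 5)
    (var : ∀ x, p (var x)) (three : ∀ k a b c, p (op k (.var a) (.var b) (.var c)))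
    (left : ∀ k l a b c d e, p (op k (op l (.var a) (.var b) (.var c)) (.var d) (.var e)))
    (mid : ∀ k l a b c d e, p (op k (.var a) (op l (.var b) (.var c) (.var d)) (.var e)))
    (right : ∀ k l a b c d e, p (op k (.var a) (.var b) (op l (.var c) (.var d) (.var e)))) :
    p m := by
  cases m with
  | var x => exact var x
  | op k s t r =>
    have := s.degree_pos
    have := t.degree_pos
    have := r.degree_pos
    rw [degree_op] at hm
    obtain ⟨a, rfl⟩ | ⟨hs, l, a, b, c, rfl⟩ := eq_op_var_of_degree_lt_five (m := s) (by omega) <;>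
    obtain ⟨d, rfl⟩ | ⟨ht, l', d, d', d'', rfl⟩ :=
      eq_op_var_of_degree_lt_five (m := t) (by omega) <;>
    obtain ⟨e, rfl⟩ | ⟨hr, l'', e, e', e'', rfl⟩ :=
      eq_op_var_of_degree_lt_five (m := r) (by omega) <;>
    first | omega | simp only [three, left, mid, right]

end Monomial

section Degree

variable (F : Type*) [Field F] [CharZero F] {T : Type*} [AddCommGroup T] [Module F T]

/-- `splitWord` recovers the value of a monomial of degree at most 5 from its expansion into words. -/
theorem linearCombination_splitWord_eval {f g : T → T → T → T} (h : IsTripleDisystem f g)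
    (v : ℕ → T) (m : Monomial (Fin 2) ℕ) (hm : m.degree ≤ 5) :
    Finsupp.linearCombination F (splitWord F f g v)
      (m.eval (diproduct (freeDialgebra F)) fun i => Finsupp.single ⟨[], i, []⟩ 1) =
        m.eval ![f, g] v := by
  refine Monomial.cases_of_degree_le_five m hm ?_ ?_ ?_ ?_ ?_
  · intro x
    simp [Monomial.eval, splitWord]
  · intro k a b c
    fin_cases k <;> simp [Monomial.eval, diproduct, freeDialgebra, bilinearExtension_single,
      splitWord]
    · module
    · rw [h.symm (v c)]
      module
  · intro k l a b c d e
    fin_cases k <;> fin_cases l <;> simp [Monomial.eval, diproduct, freeDialgebra,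
      bilinearExtension_single, splitWord]
    · rw [← h.split_one_left F, h.splitWord₃_reverse F (v c)]
      module
    · rw [← h.split_two_left F]
      module
    · rw [h.left_symm, ← h.symm (v e), ← h.split_two_right F]
      module
    · rw [← h.left, h.symm, ← h.split_two_right F]
      module
  · intro k l a b c d e
    fin_cases k <;> fin_cases l <;> simp [Monomial.eval, diproduct, freeDialgebra,
      bilinearExtension_single, splitWord]
    · rw [← h.split_one_mid F]
      module
    · rw [← h.mid, ← h.split_one_mid F]
      module
    · rw [← h.split_two_mid_one F]
      module
    · rw [← h.split_two_mid_two F]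
      simp only [h.splitWord₃_reverse F (v a)]
      module
  · intro k l a b c d e
    fin_cases k <;> fin_cases l <;> simp [Monomial.eval, diproduct, freeDialgebra,
      bilinearExtension_single, splitWord]
    · rw [← h.split_one_right F]
      module
    · rw [← h.right, ← h.split_one_right F]
      module
    · rw [← h.split_two_right F]
      module
    · rw [h.symm, ← h.left, h.symm, ← h.split_two_right F]
      module

theorem isConsequence_of_degreeLE {F : Type u} [Field F] [CharZero F]
    (p : Poly F (Fin 2)) (hp : p.DegreeLE 5) (hid : IsDiproductIdentity.{u, w} p) :
    IsConsequence.{u, w} (Set.range (eightIdentities F)) p := by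
  intro T _ _ ω hω v
  have h := (satisfies_eightIdentities_iff F (ops ω)).1 (Set.forall_mem_range.1 hω)
  have hev := congrArg (Finsupp.linearCombination F (splitWord F (ops ω 0) (ops ω 1) v))
    (hid _ (freeDialgebra.{u, w} F) fun i => Finsupp.single ⟨[], i, []⟩ 1)
  rw [Poly.eval, Finsupp.sum, map_sum, map_zero] at hev
  rw [← hev, Poly.eval, Finsupp.sum]
  refine Finset.sum_congr rfl fun m hm => ?_
  rw [map_smul, linearCombination_splitWord_eval F h v m (hp m hm)]
  congr 2
  ext j
  fin_cases j <;> rfl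

end Degree

/-! ### Independence -/

section NilpotentModel

variable {F : Type*} [Field F] {K : Type*} [CommRing K] [Algebra F K]

open LinearMap in
/-- The trilinear operation whose value at `(a, b, c)` has `l`-th coordinate `a i * b j * c k` and is
zero in the other coordinates. -/
noncomputable def coordinateOp (i j k l : Fin 4) : Trilinear F (Fin 4 → K) :=
  ((mul F K).compl₁₂ (proj i) (proj j)).compr₂
    (((mul F K).compl₂ (proj k)).compr₂ (single F (fun _ => K) l))

theorem coordinateOp_apply (i j k l : Fin 4) (a b c : Fin 4 → K) :
    (coordinateOp i j k l : Trilinear F (Fin 4 → K)) a b c = Pi.single l (a i * b j * c k) := rfl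

/-- Two operations, nilpotent of degree 5, on the space with basis `e₀ = x` of degree 1,
`e₁ = (x,x,x)₁` and `e₂ = (x,x,x)₂` of degree 3, and `e₃` of degree 5. The number `α j m k` is the
coefficient of `e₃` in the value of the `j`-th operation with `e_{k+1}` as `m`-th argument (all
indices from 0) and `x` as the other two. The scalars are extended to an algebra `K`, which allows
`K` to be a lift of `F` to another universe. -/
noncomputable def nilpotentModel (α : Fin 2 → Fin 3 → Fin 2 → ℤ) (j : Fin 2) :
    Trilinear F (Fin 4 → K) :=
  coordinateOp 0 0 0 (![1, 2] j) +
    ∑ k, (α j 0 k • coordinateOp (![1, 2] k) 0 0 3 + α j 1 k • coordinateOp 0 (![1, 2] k) 0 3 +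
      α j 2 k • coordinateOp 0 0 (![1, 2] k) 3)

/-- The value of each degree-5 identity in `nilpotentModel α`, as a multiple of `e₃`, when all
variables are `x`. The first identity, of degree 3, has no such value; its entry `0` is not used. -/
def defect (α : Fin 2 → Fin 3 → Fin 2 → ℤ) : Fin 8 → ℤ :=
  ![0,
    α 0 1 0 - α 0 1 1,
    α 0 2 0 - α 0 2 1,
    α 1 0 0 - α 1 0 1,
    α 0 0 0 - (α 0 0 0 - α 0 1 0 + α 0 2 0),
    α 0 0 1 - (α 1 0 0 - α 1 1 0 + α 1 2 0),
    α 1 0 0 - (α 0 0 1 - α 1 1 0 + α 0 0 1),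
    α 1 1 1 - (α 0 0 0 + α 0 0 0 - α 0 1 0)]

theorem ops_nilpotentModel (α : Fin 2 → Fin 3 → Fin 2 → ℤ) (j : Fin 2) (a b c : Fin 4 → K) :
    ops (nilpotentModel (F := F) α) j a b c =
      ![0, ![1, 0] j * (a 0 * b 0 * c 0), ![0, 1] j * (a 0 * b 0 * c 0),
        α j 0 0 * (a 1 * b 0 * c 0) + α j 1 0 * (a 0 * b 1 * c 0) + α j 2 0 * (a 0 * b 0 * c 1) +
          (α j 0 1 * (a 2 * b 0 * c 0) + α j 1 1 * (a 0 * b 2 * c 0) +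
            α j 2 1 * (a 0 * b 0 * c 2))] := by
  ext l
  fin_cases j <;> fin_cases l <;>
    simp [ops, nilpotentModel, coordinateOp_apply, LinearMap.add_apply]

theorem eval_nilpotentModel (α : Fin 2 → Fin 3 → Fin 2 → ℤ) (v : ℕ → Fin 4 → K) (i : Fin 8)
    (hi : i ≠ 0) :
    (eightIdentities F i).eval (ops (nilpotentModel (F := F) α)) v =
      ![0, 0, 0, defect α i * (v 0 0 * v 1 0 * v 2 0 * v 3 0 * v 4 0)] := by
  fin_cases i
  · exact absurd rfl hi
  all_goals
    simp [eightIdentities, Monomial.eval, p₁, p₂, ops_nilpotentModel, defect]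
    ring

/-- Structure constants for which `nilpotentModel` violates the `i`-th identity and satisfies the
others. For `i = 0` the operation `(·,·,·)₂` fails to be symmetric only on a degree-3 argument. -/
def independenceParameters : Fin 8 → Fin 2 → Fin 3 → Fin 2 → ℤ :=
  ![![0, ![0, 0, ![0, 1]]],
    ![![0, ![0, 1], 0], 0],
    ![![0, 0, ![0, 1]], 0],
    ![0, ![![0, 1], 0, ![0, 1]]],
    ![![0, 0, ![1, 1]], 0],
    ![![![0, 1], 0, 0], ![0, ![2, 0], 0]],
    ![![![0, 1], 0, 0], ![0, ![-1, 0], 0]],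
    ![0, ![0, ![0, 1], 0]]]

theorem defect_independenceParameters (i j : Fin 8) (hj : j ≠ 0) :
    defect (independenceParameters i) j = 0 ↔ j ≠ i := by
  revert i j
  decide

theorem independenceParameters_symm (i : Fin 8) (hi : i ≠ 0) (k : Fin 2) :
    independenceParameters i 1 0 k = independenceParameters i 1 2 k := by
  revert i k
  decide

theorem nilpotentModel_symm {α : Fin 2 → Fin 3 → Fin 2 → ℤ} (hα : ∀ k, α 1 0 k = α 1 2 k) :
    Satisfies (ops (nilpotentModel (F := F) (K := K) α)) (eightIdentities F 0) := by
  intro v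
  simp [eightIdentities, Monomial.eval, p₂, ops_nilpotentModel, hα]
  ring_nf
  simp

end NilpotentModel

theorem not_isConsequence_compl (F : Type u) [Field F] [CharZero F] (i : Fin 8) :
    ¬ IsConsequence.{u, w} (eightIdentities F '' {i}ᶜ) (eightIdentities F i) := by
  intro h
  have hi := h (Fin 4 → ULift.{w} F) (nilpotentModel (independenceParameters i)) ?_
  · by_cases h0 : i = 0
    · subst h0
      -- The arguments `x, x, (x,x,x)₂` separate `(a,b,c)₂` from `(c,b,a)₂`.
      have := congrFun (hi fun n => ([Pi.single 0 1, Pi.single 0 1, Pi.single 2 1] :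
        List (Fin 4 → ULift.{w} F)).getD n 0) 3
      simp [eightIdentities, Monomial.eval, p₂, ops_nilpotentModel, independenceParameters] at this
    · have := congrFun (hi fun _ => Pi.single 0 1) 3
      rw [eval_nilpotentModel _ _ _ h0] at this
      have hd : (defect (independenceParameters i) i : ULift.{w} F) ≠ 0 := by
        intro h
        have := congrArg ULift.down h
        simp [defect_independenceParameters i i h0] at this
      exact hd (by simpa using this)
  · rintro _ ⟨j, hj, rfl⟩
    by_cases h0 : j = 0
    · subst h0
      exact nilpotentModel_symm (independenceParameters_symm i (Ne.symm hj))
    · intro v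
      rw [eval_nilpotentModel _ _ _ h0, (defect_independenceParameters i j h0).2 hj]
      ext l
      fin_cases l <;> simp

/-! ### The output of the Kolesnikov-Pozhidaev algorithm -/

section KPOutput

variable {F : Type*} [Field F] {T : Type*} [AddCommGroup T] [Module F T]

theorem satisfies_sub_mon_iff {ι : Type} (ω : ι → T → T → T → T) (m n : Monomial ι ℕ) :
    Satisfies ω (mon m - mon n : Poly F ι) ↔ ∀ v, m.eval ω v = n.eval ω v := by
  simp [Satisfies, sub_eq_zero]

theorem mapDomain_mon {ι κ : Type} (φ : Monomial ι ℕ → Monomial κ ℕ) (m : Monomial ι ℕ) :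
    Finsupp.mapDomain φ (mon m : Poly F ι) = mon (φ m) :=
  Finsupp.mapDomain_single

theorem mapDomain_sub {ι κ : Type} (φ : Monomial ι ℕ → Monomial κ ℕ) (p q : Poly F ι) :
    Finsupp.mapDomain φ (p - q) = Finsupp.mapDomain φ p - Finsupp.mapDomain φ q :=
  map_sub (Finsupp.lmapDomain F F φ) p q

theorem satisfies_kpOutput_iff_generators (ω : Fin 3 → T → T → T → T) :
    (∀ g ∈ kpOutput (jordanTripleSystemIdentities F), Satisfies ω g) ↔
      ((∀ x < 3, Satisfies ω (Finsupp.mapDomain (Monomial.kp x)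
        (mon (br (.var 0) (.var 1) (.var 2)) -
          mon (br (.var 2) (.var 1) (.var 0)) : Poly F Unit))) ∧
       (∀ x < 5, Satisfies ω (Finsupp.mapDomain (Monomial.kp x)
        (mon (br (.var 0) (.var 1) (br (.var 2) (.var 3) (.var 4))) -
          (mon (br (br (.var 0) (.var 1) (.var 2)) (.var 3) (.var 4)) -
            mon (br (.var 2) (br (.var 1) (.var 0) (.var 3)) (.var 4)) +
            mon (br (.var 2) (.var 3) (br (.var 0) (.var 1) (.var 4)))) : Poly F Unit)))) ∧
        ∀ i j k l : Fin 3, i ≠ j → ∀ v : ℕ → T,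
          (nested j i k).eval ω v = (nested j i l).eval ω v := by
  simp only [kpOutput, jordanTripleSystemIdentities, Set.mem_union, Set.mem_ofPred_eq, or_imp,
    forall_and, Set.mem_insert_iff, Set.mem_singleton_iff, exists_eq_or_imp, exists_eq_left,
    forall_exists_index, and_imp, ← satisfies_sub_mon_iff (F := F)]
  refine and_congr (and_congr ?_ ?_) ?_
  · exact ⟨fun h x hx => h _ x hx rfl, by rintro h _ x hx rfl; exact h x hx⟩
  · exact ⟨fun h x hx => h _ x hx rfl, by rintro h _ x hx rfl; exact h x hx⟩
  · exact ⟨fun h i j k l hij => h _ i j k l hij rfl, by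
      rintro h _ i j k l hij rfl; exact h i j k l hij⟩

theorem satisfies_kpOutput_iff (ω : Fin 3 → T → T → T → T) :
    (∀ g ∈ kpOutput (jordanTripleSystemIdentities F), Satisfies ω g) ↔
      (∀ a b c, ω 2 a b c = ω 0 c b a) ∧ IsTripleDisystem (ω 0) (ω 1) := by
  rw [satisfies_kpOutput_iff_generators]
  constructor
  · rintro ⟨⟨h3, h5⟩, hn⟩
    have H3 (a b c : T) (x : ℕ) (hx : x < 3) := h3 x hx fun n => [a, b, c].getD n 0
    have H5 (a b c d e : T) (x : ℕ) (hx : x < 5) := h5 x hx fun n => [a, b, c, d, e].getD n 0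
    have op₂ (a b c : T) : ω 2 a b c = ω 0 c b a := by
      have := H3 a b c 2 (by norm_num)
      simpa [mapDomain_sub, mapDomain_mon, br, Monomial.kp, Monomial.vars, Monomial.relabel,
        Monomial.eval, sub_eq_zero] using this
    have H5a (a b c d e : T) := H5 a b c d e 0 (by norm_num)
    have H5b (a b c d e : T) := H5 a b c d e 1 (by norm_num)
    have H5d (a b c d e : T) := H5 a b c d e 3 (by norm_num)
    have H5e (a b c d e : T) := H5 a b c d e 4 (by norm_num)
    have Hn (i j k : Fin 3) (hij : i ≠ j) (a b c x y z : T) :=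
      hn i j k 0 hij fun n => [a, b, c, x, y, z].getD n 0
    simp [mapDomain_sub, Finsupp.mapDomain_add, mapDomain_mon, br, Monomial.kp, Monomial.vars,
      Monomial.relabel, Monomial.eval, sub_eq_zero, op₂] at H5a H5b H5d H5e
    -- Marking `c` in the degree-5 identity gives nothing that marking `e` does not give.
    refine ⟨op₂, ?_⟩
    have symm (a b c : T) : ω 1 a b c = ω 1 c b a := by
      simpa [mapDomain_sub, mapDomain_mon, br, Monomial.kp, Monomial.vars, Monomial.relabel,
        Monomial.eval, sub_eq_zero] using H3 a b c 1 (by norm_num)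
    have mid (k : Fin 3) (a b c d e : T) : ω 0 a (ω k b c d) e = ω 0 a (ω 0 b c d) e := by
      simpa [nested, Monomial.eval] using Hn 1 0 k (by decide) a 0 e b c d
    have right (k : Fin 3) (a b c d e : T) : ω 0 a b (ω k c d e) = ω 0 a b (ω 0 c d e) := by
      simpa [nested, Monomial.eval] using Hn 2 0 k (by decide) a b 0 c d e
    have left (k : Fin 3) (a b c d e : T) : ω 1 (ω k a b c) d e = ω 1 (ω 0 a b c) d e := by
      simpa [nested, Monomial.eval] using Hn 0 1 k (by decide) 0 d e a b c
    have left_symm (a b c d e : T) : ω 1 (ω 0 a b c) d e = ω 1 (ω 0 c b a) d e := by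
      rw [← left 2, op₂]
    exact IsKPDisystem.isTripleDisystem
      { symm := symm
        mid := fun a b c d e => (mid 1 a b c d e).symm
        mid' := fun a b c d e => by rw [mid, ← mid 2, op₂]
        right := fun a b c d e => (right 1 a b c d e).symm
        right' := fun a b c d e => by rw [right, ← right 2, op₂]
        left := fun a b c d e => (left 1 a b c d e).symm
        left' := fun a b c d e => by rw [left, left_symm]
        one_one := fun a b c d e => by rw [H5e]; abel
        two_one := fun a b c d e => by
          rw [H5d, symm e d (ω 0 a b c), symm e d (ω 0 c b a), left_symm a b c]
        one_right := H5a
        two_right := H5b }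
  · rintro ⟨op₂, h⟩
    refine ⟨⟨?_, ?_⟩, ?_⟩
    · intro x hx v
      interval_cases x <;> simp [mapDomain_sub, mapDomain_mon, br, Monomial.kp, Monomial.vars,
        Monomial.relabel, Monomial.eval, sub_eq_zero, op₂]
      exact h.symm _ _ _
    · intro x hx v
      interval_cases x <;> simp [mapDomain_sub, Finsupp.mapDomain_add, mapDomain_mon, br,
        Monomial.kp, Monomial.vars, Monomial.relabel, Monomial.eval, sub_eq_zero, op₂]
      · exact h.one_right ..
      · exact h.isKPDisystem.two_right ..
      · rw [h.one_one, h.mid_symm, h.right_symm]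
      · rw [h.two_one, h.symm _ _ (ω 0 (v 4) (v 1) (v 0)), h.left_symm (v 4),
          h.symm (ω 0 (v 0) (v 1) (v 4))]
      · rw [h.one_one]
        abel
    · have key (i j k : Fin 3) (hij : i ≠ j) (v : ℕ → T) :
          (nested j i k).eval ω v = (nested j i 0).eval ω v := by
        fin_cases i <;> fin_cases j <;> first | exact absurd rfl hij | skip
        all_goals
          fin_cases k <;> simp [nested, Monomial.eval, op₂]
        · exact (h.left ..).symm
        · exact h.left_symm ..
        · exact (h.right ..).symm
        · exact h.right_symm ..
        · exact (h.mid ..).symm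
        · exact h.mid_symm ..
        · exact (h.mid ..).symm
        · exact h.mid_symm ..
        · exact (h.right ..).symm
        · exact h.right_symm ..
        · rw [h.symm, ← h.left, h.symm]
        · rw [h.symm, h.left_symm, h.symm]
      intro i j k l hij v
      rw [key i j k hij, key i j l hij]

end KPOutput

end JordanTriple

open JordanTriple in
/-- Over a field of characteristic zero:
(1) the eight identities hold for the Jordan triple diproducts of every associative dialgebra;
(2) every polynomial identity of degree at most 5 of these diproducts is a consequence of them;
(3) they are independent: none is a consequence of the other seven;
(4) they are equivalent to the identities in two operations that the Kolesnikov-Pozhidaev algorithm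
gives for Jordan triple systems;
(5) three trilinear operations satisfy the direct output of that algorithm if and only if the third
is the opposite of the first and the first two satisfy the eight identities. -/
theorem theorem4p6 (F : Type u) [Field F] [CharZero F] :
    (∀ i, IsDiproductIdentity.{u, w} (eightIdentities F i)) ∧
    (∀ f : Poly F (Fin 2), f.DegreeLE 5 → IsDiproductIdentity.{u, w} f →
      IsConsequence.{u, w} (Set.range (eightIdentities F)) f) ∧
    (∀ i, ¬ IsConsequence.{u, w} (eightIdentities F '' {i}ᶜ) (eightIdentities F i)) ∧
    ((∀ i, IsConsequence.{u, w} (Set.range (eightIdentities F)) (kpIdentities F i)) ∧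
      (∀ i, IsConsequence.{u, w} (Set.range (kpIdentities F)) (eightIdentities F i))) ∧
    (∀ (T : Type (max u w)) [AddCommGroup T] [Module F T] (ω : Fin 3 → Trilinear F T),
      (∀ g ∈ kpOutput (jordanTripleSystemIdentities F), Satisfies (ops ω) g) ↔
        (∀ a b c : T, ω 2 a b c = ω 0 c b a) ∧
          ∀ i, Satisfies (ops ![ω 0, ω 1]) (eightIdentities F i)) := by
  refine ⟨fun i D _ _ A => ?_, isConsequence_of_degreeLE, not_isConsequence_compl F, ⟨?_, ?_⟩, ?_⟩
  · exact (satisfies_eightIdentities_iff F _).2 (isTripleDisystem_diproduct A) i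
  · intro i T _ _ ω hω
    exact (satisfies_kpIdentities_iff F _).2 ((satisfies_eightIdentities_iff F _).1
      (Set.forall_mem_range.1 hω)).isKPDisystem i
  · intro i T _ _ ω hω
    exact (satisfies_eightIdentities_iff F _).2 ((satisfies_kpIdentities_iff F _).1
      (Set.forall_mem_range.1 hω)).isTripleDisystem i
  · intro T _ _ ω
    rw [satisfies_kpOutput_iff, satisfies_eightIdentities_iff]
    rfl
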